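/- Identify a set $S\subseteq\omega$ with its characteristic sequence in $2^\omega$. A set $G\subseteq\omega$ is *1-generic* if for every c.e. set $W\subseteq 2^{<\omega}$ there is an initial segment $\sigma$ of $G$ such that $\sigma\in W$ or no extension $\tau\succeq\sigma$ is in $W$. For an infinite $I=\{i_0<i_1<i_2<\cdots\}\subseteq\omega$ and $A\subseteq\omega$, the *$I$-subsequence* of $A$ is $A_I=\{n : i_n\in A\}$. An infinite set $I$ is a *subsequence set for 1-genericity* if $G_I$ is 1-generic for every 1-generic $G$. An infinite set $X$ is *hyperimmune* if there is no computable sequence $(F_n)_{n\in\omega}$ of pairwise disjoint finite sets (given by canonical indices) with $F_n\cap X\neq\emptyset$ for all $n$. A non-computable set $I$ is *wild* (respectively *tame*) if there is a computable strictly increasing $f:\omega\to\omega$ such that $I\cap(f(n),f(n+1))\neq\emptyset$ for every $n$ and the function $h(n)=|I\cap(f(n),f(n+1))|$ is non-computable (respectively computable); here $(a,b)$ is the open interval of natural numbers. **Theorem.** Every subsequence set for 1-genericity is computable. That is, for every non-computable $I\subseteq\omega$ there is a 1-generic $G$ such that $G_I$ is not 1-generic. More precisely, let $I$ be non-computable.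 1. If $I$ is hyperimmune, then there is a 1-generic $G\supseteq I$; for it $G_I=\omega$, which is not 1-generic. 2. If $I$ is not hyperimmune, then $I$ is wild or tame. 3. If $I$ is wild, then there is a 1-generic $A$ such that $A_I\geq_T\emptyset'$; in particular $A_I$ is not 1-generic. 4. If $I$ is tame, then there is a 1-generic $A$ such that $A_I\geq_T\emptyset'$; in particular $A_I$ is not 1-generic. -/

import Mathlib

open scoped Computability

/-- The set `S ⊆ ω` is computable (recursive). -/
def IsComputableSet (S : Set ℕ) : Prop :=
  ComputablePred (fun n => n ∈ S)

/-- `σ ≺ G`: the binary string `σ` is an initial segment of (the characteristic sequence of) `G`. -/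
def IsInitialSegment (σ : List Bool) (G : Set ℕ) : Prop :=
  ∀ (i : ℕ) (hi : i < σ.length), σ[i] = true ↔ i ∈ G

/-- `G` is 1-generic: for every c.e. set `W` of binary strings, some initial segment of `G` either
belongs to `W` or has no extension in `W`. -/
def OneGeneric (G : Set ℕ) : Prop :=
  ∀ W : Set (List Bool), REPred (fun σ => σ ∈ W) →
    ∃ σ : List Bool, IsInitialSegment σ G ∧ (σ ∈ W ∨ ∀ τ : List Bool, σ <+: τ → τ ∉ W)

/-- The principal function `P_I` of an infinite set `I`: `P_I(n)` is the `n`-th element of `I` in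
increasing order, counting from `0`. -/
noncomputable def principalFunction (I : Set ℕ) (n : ℕ) : ℕ :=
  Nat.nth (fun k => k ∈ I) n

/-- The `I`-subsequence `A_I` of `A`, for infinite `I`: `A_I(n) = A(P_I(n))`. -/
def subsequence (A I : Set ℕ) : Set ℕ :=
  {n | principalFunction I n ∈ A}

/-- `I` is a subsequence set for 1-genericity. (`G_I` makes sense for infinite `I` only.) -/
def IsSubsequenceSet (I : Set ℕ) : Prop :=
  I.Infinite ∧ ∀ G : Set ℕ, OneGeneric G → OneGeneric (subsequence G I)

/-- `X` is hyperimmune: it is infinite, and no computable sequence of pairwise disjoint finite sets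
(given explicitly, as lists of their elements) has all its terms meeting `X`. -/
def Hyperimmune (X : Set ℕ) : Prop :=
  X.Infinite ∧ ¬ ∃ F : ℕ → List ℕ, Computable F ∧
    (∀ m n : ℕ, m ≠ n → List.Disjoint (F m) (F n)) ∧ ∀ n : ℕ, ∃ x ∈ F n, x ∈ X

/-- `h(n) = |I ∩ (f(n), f(n+1))|`. -/
noncomputable def blockCount (I : Set ℕ) (f : ℕ → ℕ) (n : ℕ) : ℕ :=
  (I ∩ Set.Ioo (f n) (f (n + 1))).ncard

/-- `I` is wild. -/
def Wild (I : Set ℕ) : Prop :=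
  ¬ IsComputableSet I ∧ ∃ f : ℕ → ℕ, Computable f ∧ StrictMono f ∧
    (∀ n : ℕ, (I ∩ Set.Ioo (f n) (f (n + 1))).Nonempty) ∧ ¬ Computable (blockCount I f)

/-- `I` is tame. -/
def Tame (I : Set ℕ) : Prop :=
  ¬ IsComputableSet I ∧ ∃ f : ℕ → ℕ, Computable f ∧ StrictMono f ∧
    (∀ n : ℕ, (I ∩ Set.Ioo (f n) (f (n + 1))).Nonempty) ∧ Computable (blockCount I f)

open Classical in
/-- The characteristic function of `S`, as a (total) function that can serve as an oracle. -/
noncomputable def charFun (S : Set ℕ) : ℕ →. ℕ :=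
  fun n => Part.some (if n ∈ S then 1 else 0)

/-- `A ≤_T B`, for sets of natural numbers. -/
def SetTuringLE (A B : Set ℕ) : Prop :=
  charFun A ≤ᵀ charFun B

/-- The halting problem `∅'`: the set of `e` such that the `e`-th program halts on input `e`. -/
def haltingSet : Set ℕ :=
  {e | ((Denumerable.ofNat Nat.Partrec.Code e).eval e).Dom}

/-!
Why a non-computable `I` is never a subsequence set for 1-genericity.

If `I` is hyperimmune, a 1-generic `G ⊇ I` is built by finite extension
(`exists_oneGeneric_superset`). The only obstacle at a string `u ⊇ I` is a c.e. set that contains an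
extension of every `u1^k` but no extension of `u` that is `1` throughout `I`. The extensions of the
`u1^k` found by a search then have zeros on `I` arbitrarily far out, which yields a computable sequence
of disjoint intervals meeting `I` (`exists_intervals_of_search`).

If `I` is not hyperimmune, there is a computable increasing `f` such that `I` meets every interval
`(f n, f (n + 1))` (`exists_blocks_of_not_hyperimmune`). Whether `I` is then called wild or tame depends
on the block counts of `f`, but one construction serves both cases
(`exists_oneGeneric_haltingSet_le`). It builds a 1-generic `A` such that `∅'` can be read off from
`A_I`. Write `C(x)` for the number of elements of `I` below `x`.

* Messages. The string `Message.write f μ` extends `u` by four runs `1…10…01…10…0` and does not refer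
  to `I`. It is long enough for `I` to meet its runs, so the end of its third run shows up in `A_I` at
  a position `C(f g)`, where `g = growth f k` is the `k`-th term of a fast growing computable sequence
  and `k` codes the message. Since `g ≤ C(f g) ≤ f g` and the intervals `[g, f g]` are disjoint, the
  position determines `k`. Hence a decoder that sees only `A_I` recovers the message, and with it the
  string `u` and the string written. It also sees the number `C(|u| + x)`, the position at which the
  first run ends, and the message contains a guess `m` for this number.
* Genericity. A right guess announces that the string written already decides the current c.e. set, a
  wrong one that the search for an extension in this set succeeds. If no message could be sent
  truthfully, then `C(|u| + x) = m` would hold exactly if the message with the offset `x` and the guess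
  `m` has an extension in the c.e. set. The graph of `C` would be c.e. from some point on, and `I`
  would be computable (`exists_isStage`, `isComputableSet_of_countBelow`).
* Synchronisation. The decoder repeats the search if it is told to, and so knows the string `τ`
  reached by the stage, but not `C(|τ|)`. Zeros are appended to `τ` until exactly `|τ|` elements of `I`
  have been passed; the next message starts at position `|τ|` of `A_I`. Each message carries one bit
  of `∅'`.

Finally, no 1-generic set computes `∅'` (`not_oneGeneric_of_haltingSet_le`), so `A_I` is not 1-generic.
The interface between Turing reducibility and finite strings is given by
`Nat.RecursiveIn.exists_functional` (the use principle) and, in the opposite direction,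
`setTuringLE_of_functional`.
-/

/-! ### Computably enumerable predicates -/

section Enumeration

open Nat.Partrec Encodable Denumerable

variable {α β : Type*} [Primcodable α] [Primcodable β]

/-- A c.e. predicate is the domain of a program. -/
theorem REPred.exists_code {p : α → Prop} (hp : REPred p) :
    ∃ c : Code, ∀ a, p a ↔ (c.eval (encode a)).Dom := by
  obtain ⟨c, hc⟩ := Code.exists_code.1 hp
  refine ⟨c, fun a => ?_⟩
  rw [hc]
  simp [Part.assert]

/-- A c.e. predicate is the projection of a computable one. -/
theorem REPred.exists_computable {p : α → Prop} (hp : REPred p) :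
    ∃ q : α → ℕ → Bool, Computable₂ q ∧ ∀ a, p a ↔ ∃ k, q a k = true := by
  obtain ⟨c, hc⟩ := hp.exists_code
  refine ⟨fun a k => (c.evaln k (encode a)).isSome, ?_, fun a => ?_⟩
  · exact Primrec.to_comp (Primrec.option_isSome.comp (Code.primrec_evaln.comp
      ((Primrec.snd.pair (Primrec.const c)).pair (Primrec.encode.comp Primrec.fst))))
  · rw [hc, Part.dom_iff_mem]
    simp only [Code.evaln_complete, Option.isSome_iff_exists, Option.mem_def]
    exact exists_comm

theorem Computable₂.rePred_exists {q : α → ℕ → Bool} (hq : Computable₂ q) :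
    REPred fun a => ∃ k, q a k = true := by
  refine (Partrec.rfind (p := fun a n => Part.some (q a n)) hq.partrec₂).dom_re.of_eq fun a => ?_
  refine Nat.rfind_dom.trans ?_
  simp only [Part.mem_some_iff, Part.some_dom, implies_true, and_true, eq_comm]

theorem REPred.exists_nat {p : α → ℕ → Prop} (hp : REPred fun a : α × ℕ => p a.1 a.2) :
    REPred fun a => ∃ n, p a n := by
  obtain ⟨q, hq, h⟩ := hp.exists_computable
  refine (Computable₂.rePred_exists (q := fun a k => q (a, k.unpair.1) k.unpair.2) ?_).of_eq
    fun a => ?_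
  · exact hq.comp (Computable.fst.pair (Computable.fst.comp (Computable.unpair.comp Computable.snd)))
      (Computable.snd.comp (Computable.unpair.comp Computable.snd))
  · simp only [fun n => h (a, n)]
    constructor
    · rintro ⟨k, hk⟩
      exact ⟨_, _, hk⟩
    · rintro ⟨n, k, hk⟩
      exact ⟨Nat.pair n k, by simpa using hk⟩

theorem REPred.comp {p : β → Prop} (hp : REPred p) {f : α → β} (hf : Computable f) :
    REPred fun a => p (f a) :=
  Partrec.comp hp hf

theorem REPred.and {p q : α → Prop} (hp : REPred p) (hq : REPred q) :
    REPred fun a => p a ∧ q a := by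
  refine (Partrec.bind hp (g := fun a _ => Part.assert (q a) fun _ => Part.some ())
    (Partrec.comp hq Computable.fst)).dom_re.of_eq fun a => ?_
  simp [Part.bind_dom, Part.assert]

theorem ComputablePred.comp {α β : Type*} [Primcodable α] [Primcodable β] {p : β → Prop}
    (hp : ComputablePred p) {f : α → β} (hf : Computable f) : ComputablePred fun a => p (f a) := by
  classical
  exact Computable.computablePred (hp.decide.comp hf)

end Enumeration

/-! ### Initial segments -/

section InitialSegments

open Classical in
/-- The initial segment of length `n` of the characteristic sequence of `A`. -/
noncomputable def initSeg (A : Set ℕ) (n : ℕ) : List Bool :=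
  (List.range n).map fun i => decide (i ∈ A)

@[simp] theorem length_initSeg (A : Set ℕ) (n : ℕ) : (initSeg A n).length = n := by
  simp [initSeg]

theorem getElem?_initSeg_eq_some {A : Set ℕ} {n i : ℕ} {b : Bool} :
    (initSeg A n)[i]? = some b ↔ i < n ∧ (b = true ↔ i ∈ A) := by
  classical
  by_cases hi : i < n
  · cases b <;> simp [initSeg, hi]
  · simp [initSeg, hi]

theorem isInitialSegment_iff {σ : List Bool} {A : Set ℕ} :
    IsInitialSegment σ A ↔ ∀ i b, σ[i]? = some b → (b = true ↔ i ∈ A) := by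
  constructor
  · intro h i b hb
    obtain ⟨hi, rfl⟩ := List.getElem?_eq_some_iff.1 hb
    exact h i hi
  · intro h i hi
    exact h i _ (List.getElem?_eq_getElem hi)

theorem isInitialSegment_initSeg (A : Set ℕ) (n : ℕ) : IsInitialSegment (initSeg A n) A :=
  isInitialSegment_iff.2 fun _ _ h => (getElem?_initSeg_eq_some.1 h).2

theorem IsInitialSegment.eq_initSeg {σ : List Bool} {A : Set ℕ} (h : IsInitialSegment σ A) :
    σ = initSeg A σ.length := by
  refine List.ext_getElem (by simp) fun i hi _ => ?_
  have h1 := h i hi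
  have h2 := isInitialSegment_initSeg A σ.length i (by simpa using hi)
  exact Bool.eq_iff_iff.2 (h1.trans h2.symm)

theorem initSeg_prefix (A : Set ℕ) {m n : ℕ} (h : m ≤ n) : initSeg A m <+: initSeg A n := by
  rw [List.prefix_iff_getElem?]
  intro i hi
  have := (getElem?_initSeg_eq_some (A := A) (n := m)).1 (List.getElem?_eq_getElem hi)
  exact getElem?_initSeg_eq_some.2 ⟨this.1.trans_le h, this.2⟩

theorem IsInitialSegment.of_prefix {σ τ : List Bool} {A : Set ℕ} (h : IsInitialSegment τ A)
    (hp : σ <+: τ) : IsInitialSegment σ A := by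
  intro i hi
  rw [hp.getElem hi]
  exact h i _

end InitialSegments

/-! ### The use principle -/

section Use

/-- `Nat.mem_rfind`, for a predicate that is not syntactically a `PFun`. -/
theorem mem_rfind_iff {p : ℕ → Part Bool} {n : ℕ} :
    n ∈ Nat.rfind p ↔ true ∈ p n ∧ ∀ m < n, false ∈ p m :=
  Nat.mem_rfind

open Filter

/-- The use principle: a function computed with the oracle `G` is the limit, along the initial
segments of `G`, of a monotone partial recursive functional on finite strings. -/
theorem Nat.RecursiveIn.exists_functional {G : Set ℕ} {f : ℕ →. ℕ}
    (hf : Nat.RecursiveIn {charFun G} f) :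
    ∃ F : List Bool → ℕ →. ℕ, Partrec₂ F ∧
      (∀ σ τ x y, σ <+: τ → y ∈ F σ x → y ∈ F τ x) ∧
      ∀ x y, y ∈ f x ↔ ∃ n, y ∈ F (initSeg G n) x := by
  -- For a monotone functional, "at some initial segment" is "at almost all initial segments".
  have ev : ∀ {F : List Bool → ℕ →. ℕ}, (∀ σ τ x y, σ <+: τ → y ∈ F σ x → y ∈ F τ x) →
      ∀ x y, (∃ n, y ∈ F (initSeg G n) x) ↔ ∀ᶠ n in atTop, y ∈ F (initSeg G n) x := by
    intro F hF x y
    constructor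
    · rintro ⟨n, hn⟩
      filter_upwards [eventually_ge_atTop n] with m hm
      exact hF _ _ _ _ (initSeg_prefix G hm) hn
    · exact fun h => h.exists
  induction hf with
  | zero =>
    exact ⟨fun _ _ => Part.some 0, (Computable.const 0).partrec.to₂, by simp, by
      intro x y; exact ⟨fun h => ⟨0, h⟩, fun ⟨_, h⟩ => h⟩⟩
  | succ =>
    exact ⟨fun _ x => Part.some x.succ, (Computable.succ.comp Computable.snd).partrec.to₂,
      by simp, by simp⟩
  | left =>
    exact ⟨fun _ x => Part.some x.unpair.1,
      (Computable.fst.comp (Computable.unpair.comp Computable.snd)).partrec.to₂, by simp, by simp⟩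
  | right =>
    exact ⟨fun _ x => Part.some x.unpair.2,
      (Computable.snd.comp (Computable.unpair.comp Computable.snd)).partrec.to₂, by simp, by simp⟩
  | oracle g hg =>
    obtain rfl : g = charFun G := hg
    refine ⟨fun σ x => ((σ[x]?).map Bool.toNat : Option ℕ), ?_, ?_, ?_⟩
    · exact Computable.ofOption (Computable.option_map
        (Computable.list_getElem?.comp Computable.fst Computable.snd)
        ((Primrec.dom_bool Bool.toNat).to_comp.comp Computable.snd).to₂)
    · intro σ τ x y h
      simp only [Part.mem_coe, Option.mem_def, Option.map_eq_some_iff]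
      rintro ⟨b, hb, rfl⟩
      obtain ⟨t, rfl⟩ := h
      exact ⟨b, by rw [List.getElem?_append_left (List.getElem?_eq_some_iff.1 hb).1, hb], rfl⟩
    · intro x y
      simp only [Part.mem_coe, Option.mem_def, Option.map_eq_some_iff, getElem?_initSeg_eq_some,
        charFun, Part.mem_some_iff]
      constructor
      · rintro rfl
        by_cases h : x ∈ G
        · exact ⟨x + 1, true, by simp [h]⟩
        · exact ⟨x + 1, false, by simp [h]⟩
      · rintro ⟨n, b, ⟨-, hb⟩, rfl⟩
        cases b <;> simp_all
  | @pair f h _ _ ihf ihh =>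
    obtain ⟨F, hF, mF, eF⟩ := ihf
    obtain ⟨H, hH, mH, eH⟩ := ihh
    refine ⟨fun σ x => (F σ x).bind fun a => (H σ x).map (Nat.pair a), ?_, ?_, ?_⟩
    · refine Partrec.bind hF (Partrec.map (Partrec₂.comp hH (Computable.fst.comp Computable.fst)
        (Computable.snd.comp Computable.fst)) ?_)
      exact (Primrec₂.natPair.to_comp.comp (Computable.snd.comp Computable.fst)
        Computable.snd).to₂
    · intro σ τ x y h
      simp only [Part.mem_bind_iff, Part.mem_map_iff]
      rintro ⟨a, ha, b, hb, rfl⟩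
      exact ⟨a, mF _ _ _ _ h ha, b, mH _ _ _ _ h hb, rfl⟩
    · intro x y
      simp only [Seq.seq, Part.map_eq_map, Part.mem_bind_iff, Part.mem_map_iff, eF, eH, ev mF, ev mH]
      constructor
      · rintro ⟨_, ⟨a, ha, rfl⟩, b, hb, rfl⟩
        obtain ⟨n, hn⟩ := (ha.and hb).exists
        exact ⟨n, a, hn.1, b, hn.2, rfl⟩
      · rintro ⟨n, a, ha, b, hb, rfl⟩
        exact ⟨_, ⟨a, (ev mF _ _).1 ⟨n, ha⟩, rfl⟩, b, (ev mH _ _).1 ⟨n, hb⟩, rfl⟩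
  | @comp f h _ _ ihf ihh =>
    obtain ⟨F, hF, mF, eF⟩ := ihf
    obtain ⟨H, hH, mH, eH⟩ := ihh
    refine ⟨fun σ x => (H σ x).bind fun a => F σ a, ?_, ?_, ?_⟩
    · exact Partrec.bind hH (Partrec₂.comp hF (Computable.fst.comp Computable.fst) Computable.snd)
    · intro σ τ x y h
      simp only [Part.mem_bind_iff]
      rintro ⟨a, ha, hb⟩
      exact ⟨a, mH _ _ _ _ h ha, mF _ _ _ _ h hb⟩
    · intro x y
      refine (Part.mem_bind_iff (f := h x) (g := f)).trans ?_
      simp only [Part.mem_bind_iff, eF, eH, ev mF, ev mH]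
      constructor
      · rintro ⟨a, ha, hb⟩
        obtain ⟨n, hn⟩ := (ha.and hb).exists
        exact ⟨n, a, hn.1, hn.2⟩
      · rintro ⟨n, a, ha, hb⟩
        exact ⟨a, (ev mH _ _).1 ⟨n, ha⟩, (ev mF _ _).1 ⟨n, hb⟩⟩
  | @prec f h _ _ ihf ihh =>
    obtain ⟨F, hF, mF, eF⟩ := ihf
    obtain ⟨H, hH, mH, eH⟩ := ihh
    let R : List Bool → ℕ → ℕ →. ℕ := fun σ a n =>
      n.rec (F σ a) fun y IH => IH.bind fun i => H σ (Nat.pair a (Nat.pair y i))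
    have mR : ∀ σ τ a n y, σ <+: τ → y ∈ R σ a n → y ∈ R τ a n := by
      intro σ τ a n y h
      induction n generalizing y with
      | zero => exact mF _ _ _ _ h
      | succ n ih =>
        simp only [R, Part.mem_bind_iff]
        rintro ⟨i, hi, hy⟩
        exact ⟨i, ih _ hi, mH _ _ _ _ h hy⟩
    refine ⟨fun σ x => R σ x.unpair.1 x.unpair.2, ?_, fun σ τ x y h => mR _ _ _ _ _ h, ?_⟩
    · have c1 : Computable fun p : List Bool × ℕ => p.2.unpair.1 :=
        Computable.fst.comp (Computable.unpair.comp Computable.snd)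
      have c2 : Computable fun p : List Bool × ℕ => p.2.unpair.2 :=
        Computable.snd.comp (Computable.unpair.comp Computable.snd)
      refine Partrec.nat_rec (h := fun p q => H p.1 (Nat.pair p.2.unpair.1 (Nat.pair q.1 q.2)))
        c2 (Partrec₂.comp hF Computable.fst c1) ?_
      refine Partrec₂.comp hH (Computable.fst.comp Computable.fst) ?_
      exact Primrec₂.natPair.to_comp.comp (c1.comp Computable.fst)
        (Primrec₂.natPair.to_comp.comp (Computable.fst.comp Computable.snd)
          (Computable.snd.comp Computable.snd))
    · intro x y
      obtain ⟨a, n, rfl⟩ : ∃ a n, x = Nat.pair a n := ⟨x.unpair.1, x.unpair.2, by simp⟩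
      simp only [Nat.unpair_pair]
      induction n generalizing y with
      | zero => exact eF a y
      | succ n ih =>
        simp only [R, Part.bind_eq_bind, Part.mem_bind_iff] at ih ⊢
        simp only [ih, eH]
        constructor
        · rintro ⟨i, ⟨n1, h1⟩, n2, h2⟩
          exact ⟨max n1 n2, i, mR _ _ _ _ _ (initSeg_prefix G (le_max_left _ _)) h1,
            mH _ _ _ _ (initSeg_prefix G (le_max_right _ _)) h2⟩
        · rintro ⟨n, i, h1, h2⟩
          exact ⟨i, ⟨n, h1⟩, n, h2⟩
  | @rfind f _ ihf =>
    obtain ⟨F, hF, mF, eF⟩ := ihf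
    refine ⟨fun σ x => Nat.rfind fun n => (F σ (Nat.pair x n)).map fun m => decide (m = 0),
      ?_, ?_, ?_⟩
    · refine _root_.Partrec.rfind (p := fun (p : List Bool × ℕ) n =>
        (F p.1 (Nat.pair p.2 n)).map fun m => decide (m = 0)) (Partrec.map (Partrec₂.comp hF (Computable.fst.comp Computable.fst)
        (Primrec₂.natPair.to_comp.comp (Computable.snd.comp Computable.fst) Computable.snd)) ?_)
      exact (Primrec.eq.decide.to_comp.comp Computable.snd (Computable.const 0)).to₂
    · intro σ τ x y h
      simp only [mem_rfind_iff, Part.mem_map_iff]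
      rintro ⟨⟨a, ha, ha'⟩, h2⟩
      refine ⟨⟨a, mF _ _ _ _ h ha, ha'⟩, fun m hm => ?_⟩
      obtain ⟨b, hb, hb'⟩ := h2 _ hm
      exact ⟨b, mF _ _ _ _ h hb, hb'⟩
    · intro x y
      simp only [mem_rfind_iff, Part.map_eq_map, Part.mem_map_iff, eF]
      constructor
      · rintro ⟨⟨a, ha, ha'⟩, h2⟩
        have h3 : ∀ m ∈ Set.Iio y, ∀ᶠ n in atTop,
            ∃ b, b ∈ F (initSeg G n) (Nat.pair x m) ∧ decide (b = 0) = false := by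
          intro m hm
          obtain ⟨b, hb, hb'⟩ := h2 _ hm
          filter_upwards [(ev mF _ _).1 hb] with n hn
          exact ⟨b, hn, hb'⟩
        obtain ⟨n, h4, h5⟩ :=
          (((ev mF _ _).1 ha).and ((Filter.eventually_all_finite (Set.finite_Iio y)).2 h3)).exists
        exact ⟨n, ⟨a, h4, ha'⟩, fun m hm => h5 _ hm⟩
      · rintro ⟨n, ⟨a, ha, ha'⟩, h2⟩
        refine ⟨⟨a, ⟨n, ha⟩, ha'⟩, fun m hm => ?_⟩
        obtain ⟨b, hb, hb'⟩ := h2 _ hm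
        exact ⟨b, ⟨n, hb⟩, hb'⟩

end Use

/-! ### Reductions given by functionals on strings -/

section Oracle

open Nat.Partrec (Code)
open Encodable

/-- The binary string with code `n` (the empty string if `n` is not a code). -/
def strOf (n : ℕ) : List Bool := (decode n).getD []

@[simp] theorem strOf_encode (σ : List Bool) : strOf (encode σ) = σ := by simp [strOf]

theorem primrec_strOf : Primrec strOf :=
  Primrec.option_getD.comp Primrec.decode (Primrec.const [])

theorem Computable.nat_recursiveIn {g : ℕ → ℕ} (hg : Computable g) (O : Set (ℕ →. ℕ)) :
    Nat.RecursiveIn O (fun n => Part.some (g n)) :=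
  Nat.Partrec.recursiveIn (Partrec.nat_iff.1 hg.partrec)

theorem Nat.RecursiveIn.comp_total {O : Set (ℕ →. ℕ)} {f : ℕ →. ℕ} {g : ℕ → ℕ}
    (hf : Nat.RecursiveIn O f) (hg : Nat.RecursiveIn O (fun n => Part.some (g n))) :
    Nat.RecursiveIn O (fun n => f (g n)) :=
  (hf.comp hg).of_eq fun n => Part.bind_some (g n) f

/-- The map `n ↦ X↾n` is recursive in `X`. -/
theorem recursiveIn_initSeg (X : Set ℕ) :
    Nat.RecursiveIn {charFun X} (fun n => Part.some (encode (initSeg X n))) := by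
  have u1 : Primrec fun m : ℕ => m.unpair.1 := Primrec.fst.comp Primrec.unpair
  have u2 : Primrec fun m : ℕ => m.unpair.2 := Primrec.snd.comp Primrec.unpair
  -- On `⟨⟨a, y, i⟩, v⟩`, append the bit `v = 1` to the string coded by `i`.
  let app : ℕ → ℕ := fun m =>
    encode ((strOf m.unpair.1.unpair.2.unpair.2) ++ [decide (m.unpair.2 = 1)])
  have happ : Computable app := Primrec.to_comp <|
    Primrec.encode.comp (Primrec.list_append.comp (primrec_strOf.comp (u2.comp (u2.comp u1)))
      (Primrec.list_cons.comp (Primrec.eq.decide.comp u2 (Primrec.const 1)) (Primrec.const [])))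
  have horacle : Nat.RecursiveIn {charFun X} (fun m => charFun X m.unpair.2.unpair.1) :=
    Nat.RecursiveIn.comp_total (g := fun m => m.unpair.2.unpair.1)
      (Nat.RecursiveIn.oracle (charFun X) rfl)
      ((u1.comp u2).to_comp.nat_recursiveIn _)
  have hstep := (happ.nat_recursiveIn {charFun X}).comp
    ((Computable.id.nat_recursiveIn _).pair horacle)
  have hrec := Nat.RecursiveIn.comp_total (g := fun n => Nat.pair 0 n) (Nat.RecursiveIn.prec
    ((Computable.const (encode ([] : List Bool))).nat_recursiveIn {charFun X}) hstep)
    ((Primrec₂.natPair.comp (Primrec.const 0) Primrec.id).to_comp.nat_recursiveIn _)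
  refine hrec.of_eq fun n => ?_
  simp only [Nat.unpair_pair]
  induction n with
  | zero => simp [initSeg]
  | succ n ih =>
    refine (congrArg (Part.bind · _) ih).trans ?_
    simp only [charFun, Part.bind_eq_bind, Seq.seq, Part.map_eq_map, Part.map_some, Part.bind_some, Nat.unpair_pair,
      app, strOf_encode, initSeg, List.range_succ, List.map_append, List.map_cons,
List.map_nil, id]
    by_cases h : n ∈ X <;> simp [h]

/-- A partial recursive functional which, along the initial segments of `X`, only gives correct
answers to the question `x ∈ B`, and eventually gives one, reduces `B` to `X`. -/
theorem setTuringLE_of_functional {B X : Set ℕ} {F : List Bool → ℕ →. Bool} (hF : Partrec₂ F)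
    (sound : ∀ n x b, b ∈ F (initSeg X n) x → (b = true ↔ x ∈ B))
    (total : ∀ x, ∃ n, (F (initSeg X n) x).Dom) : SetTuringLE B X := by
  classical
  obtain ⟨c, hc⟩ := Code.exists_code.1
    (Partrec.map hF ((Primrec.dom_bool Bool.toNat).to_comp.comp Computable.snd).to₂)
  have hc' : ∀ σ x, c.eval (Nat.pair (encode σ) x) = (F σ x).map Bool.toNat := by
    intro σ x
    have := congrFun hc (encode (σ, x))
    simp only [encodek, Part.coe_some, Part.bind_some] at this
    exact this.trans (by simp [Part.map_id'])
  -- On `⟨⟨x, n, k⟩, X↾n⟩`, run the functional for `k` steps.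
  let run : ℕ → Option ℕ := fun m =>
    c.evaln m.unpair.1.unpair.2.unpair.2 (Nat.pair m.unpair.2 m.unpair.1.unpair.1)
  have u1 : Primrec fun m : ℕ => m.unpair.1 := Primrec.fst.comp Primrec.unpair
  have u2 : Primrec fun m : ℕ => m.unpair.2 := Primrec.snd.comp Primrec.unpair
  have hrun : Primrec run := Code.primrec_evaln.comp
    (((u2.comp (u2.comp u1)).pair (Primrec.const c)).pair
      (Primrec₂.natPair.comp u2 (u1.comp u1)))
  have hseg : Nat.RecursiveIn {charFun X}
      (fun m => Part.some (Nat.pair m (encode (initSeg X m.unpair.2.unpair.1)))) :=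
    ((Computable.id.nat_recursiveIn _).pair ((recursiveIn_initSeg X).comp_total
      ((u1.comp u2).to_comp.nat_recursiveIn _))).of_eq fun m => by simp [Seq.seq]
  have test : Nat.RecursiveIn {charFun X} (fun m => Part.some (if (run (Nat.pair m
      (encode (initSeg X m.unpair.2.unpair.1)))).isSome = true then 0 else 1)) := by
    have h : Primrec fun m : ℕ => if (run m).isSome = true then 0 else 1 :=
      Primrec.ite (Primrec.primrecPred (by simpa using Primrec.option_isSome.comp hrun))
        (Primrec.const 0) (Primrec.const 1)
    exact (h.to_comp.nat_recursiveIn _).comp_total hseg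
  have out : Nat.RecursiveIn {charFun X} (fun m => Part.some ((run (Nat.pair m
      (encode (initSeg X m.unpair.2.unpair.1)))).getD 0)) := by
    have h : Primrec fun m : ℕ => (run m).getD 0 :=
      Primrec.option_getD.comp hrun (Primrec.const 0)
    exact (h.to_comp.nat_recursiveIn _).comp_total hseg
  have key : Nat.RecursiveIn {charFun X} (charFun B) := by
    refine (out.comp (((Computable.id.nat_recursiveIn _)).pair test.rfind)).of_eq fun x => Part.eq_some_iff.2 ?_
    have hrx : ∀ n k, run (Nat.pair (Nat.pair x (Nat.pair n k)) (encode (initSeg X n))) =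
        c.evaln k (Nat.pair (encode (initSeg X n)) x) := by
      intro n k
      simp [run]
    have hex : ∃ z : ℕ, (run (Nat.pair (Nat.pair x z)
        (encode (initSeg X z.unpair.1)))).isSome = true := by
      obtain ⟨n, hn⟩ := total x
      obtain ⟨b, hb⟩ := Part.dom_iff_mem.1 hn
      have : b.toNat ∈ c.eval (Nat.pair (encode (initSeg X n)) x) := by
        rw [hc']
        exact Part.mem_map _ hb
      obtain ⟨k, hk⟩ := Code.evaln_complete.1 this
      refine ⟨Nat.pair n k, ?_⟩
      rw [Nat.unpair_pair, hrx, Option.mem_def.1 hk]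
      rfl
    have hz : Nat.find hex ∈ Nat.rfind fun z => (fun m => decide (m = 0)) <$> (Part.some
        (if (run (Nat.pair (Nat.pair x z) (encode (initSeg X (Nat.pair x z).unpair.2.unpair.1)))).isSome
          then 0 else 1) : Part ℕ) := by
      rw [mem_rfind_iff]
      constructor
      · simp only [Nat.unpair_pair, Nat.find_spec hex]
        simp
      · intro m hm
        simp only [Nat.unpair_pair, Nat.find_min hex hm]
        simp
    have hval : Nat.pair x (Nat.find hex) ∈ (Nat.pair <$> Part.some x <*> Nat.rfind fun z =>
        (fun m => decide (m = 0)) <$> (Part.some (if (run (Nat.pair (Nat.pair x z)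
          (encode (initSeg X (Nat.pair x z).unpair.2.unpair.1)))).isSome then 0 else 1) : Part ℕ)) := by
      simp only [Seq.seq, Part.map_eq_map, Part.map_some, Part.bind_some]
      exact Part.mem_map _ hz
    refine Part.mem_bind hval ?_
    have hs := Nat.find_spec hex
    generalize Nat.find hex = z at hs
    obtain ⟨n, k, rfl⟩ : ∃ n k, z = Nat.pair n k := ⟨z.unpair.1, z.unpair.2, by simp⟩
    simp only [Nat.unpair_pair] at hs ⊢
    obtain ⟨v, hv⟩ := Option.isSome_iff_exists.1 hs
    rw [hv, Option.getD_some, Part.mem_some_iff]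
    rw [hrx] at hv
    have h1 := Code.evaln_sound (Option.mem_def.2 hv)
    rw [hc', Part.mem_map_iff] at h1
    obtain ⟨b, hb, rfl⟩ := h1
    have h2 := sound n x b hb
    by_cases hx : x ∈ B
    · simp [hx, h2.2 hx]
    · cases b <;> simp_all
  exact RecursiveIn.iff_nat.2 key

end Oracle

/-! ### 1-generic sets do not compute the halting problem -/

section Halting

open Nat.Partrec (Code)
open Encodable Denumerable

theorem rePred_mem_haltingSet : REPred fun e => e ∈ haltingSet :=
  (Code.eval_part.comp (Computable.ofNat Code) Computable.id).dom_re

theorem not_rePred_notMem_haltingSet : ¬ REPred fun e => e ∉ haltingSet := by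
  intro h
  obtain ⟨c, hc⟩ := h.exists_code
  have := hc (encode c)
  simp [haltingSet] at this

theorem Partrec.rePred_mem {α : Type*} [Primcodable α] {f : α →. ℕ} (hf : Partrec f) (v : ℕ) :
    REPred fun a => v ∈ f a := by
  refine (Partrec.bind hf (g := fun _ y => Part.assert (y = v) fun _ => Part.some ()) ?_).dom_re.of_eq
    fun a => ?_
  · exact REPred.comp (p := fun y : ℕ => y = v)
      (ComputablePred.to_re (PrimrecPred.computablePred
        (Primrec.eq.comp Primrec.id (Primrec.const v)))) Computable.snd
  · simp only [Part.bind_dom, Part.assert]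
    constructor
    · rintro ⟨h, rfl, -⟩
      exact Part.get_mem h
    · rintro ⟨h, hv⟩
      exact ⟨h, hv, trivial⟩

/-- A 1-generic set does not compute `∅'`: if `Φ^X` were the characteristic function of `∅'`, the
c.e. set of strings `σ` such that `Φ^σ` errs by rejecting an element of `∅'` would have to be avoided
by all extensions of some initial segment `σ` of `X`, so that `x ∉ ∅'` if and only if `Φ^τ(x) = 0`
for some `τ` extending `σ`. -/
theorem not_oneGeneric_of_haltingSet_le {X : Set ℕ} (h : SetTuringLE haltingSet X) :
    ¬ OneGeneric X := by
  intro hX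
  obtain ⟨F, hF, mF, eF⟩ := Nat.RecursiveIn.exists_functional (RecursiveIn.iff_nat.1 h)
  have e0 : ∀ x, (∃ n, 0 ∈ F (initSeg X n) x) ↔ x ∉ haltingSet := by
    intro x
    rw [← eF x 0]
    by_cases hx : x ∈ haltingSet <;> simp [charFun, hx]
  have hW : REPred fun σ : List Bool => ∃ x, 0 ∈ F σ x ∧ x ∈ haltingSet :=
    REPred.exists_nat ((Partrec.rePred_mem hF 0).and (rePred_mem_haltingSet.comp Computable.snd))
  obtain ⟨σ, hσ, ⟨x, hx0, hx⟩ | hno⟩ := hX {σ | ∃ x, 0 ∈ F σ x ∧ x ∈ haltingSet} hW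
  · rw [hσ.eq_initSeg] at hx0
    exact (e0 x).1 ⟨_, hx0⟩ hx
  · refine not_rePred_notMem_haltingSet (REPred.of_eq (p := fun x => ∃ n, 0 ∈
      F (σ ++ strOf n) x) (REPred.exists_nat (REPred.comp
        (p := fun q : List Bool × ℕ => 0 ∈ F q.1 q.2) (Partrec.rePred_mem hF 0)
        (f := fun a : ℕ × ℕ => (σ ++ strOf a.2, a.1)) ?_)) fun x => ?_)
    · exact (Computable.list_append.comp (Computable.const σ)
        (primrec_strOf.to_comp.comp Computable.snd)).pair Computable.fst
    · constructor
      · rintro ⟨n, hn⟩ hx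
        exact hno _ (List.prefix_append _ _) ⟨x, hn, hx⟩
      · intro hx
        obtain ⟨n, hn⟩ := (e0 x).2 hx
        obtain ⟨ρ, hρ⟩ : σ <+: initSeg X (max n σ.length) := by
          rw [hσ.eq_initSeg]
          exact initSeg_prefix X (by simp)
        refine ⟨encode ρ, ?_⟩
        rw [strOf_encode, hρ]
        exact mF _ _ _ _ (initSeg_prefix X (le_max_left _ _)) hn

end Halting

/-! ### Searching for extensions -/

section Search

open Nat.Partrec (Code)
open Encodable Denumerable

/-- The `n`-th candidate in the search for an extension of `s` in the c.e. set of strings with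
index `c` succeeds: `n` codes a number `k` of steps and a string `ρ` such that `s ++ ρ` is enumerated
within `k` steps. -/
def accepts (c : Code) (s : List Bool) (n : ℕ) : Bool :=
  (c.evaln n.unpair.1 (encode (s ++ strOf n.unpair.2))).isSome

theorem computable_accepts :
    Computable fun p : (Code × List Bool) × ℕ => accepts p.1.1 p.1.2 p.2 :=
  (Primrec.option_isSome.comp (Code.primrec_evaln.comp
    (((Primrec.fst.comp (Primrec.unpair.comp Primrec.snd)).pair
      (Primrec.fst.comp Primrec.fst)).pair (Primrec.encode.comp (Primrec.list_append.comp
        (Primrec.snd.comp Primrec.fst) (primrec_strOf.comp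
          (Primrec.snd.comp (Primrec.unpair.comp Primrec.snd)))))))).to_comp

theorem exists_accepts_iff {c : Code} {s : List Bool} :
    (∃ n, accepts c s n = true) ↔ ∃ τ, s <+: τ ∧ (c.eval (encode τ)).Dom := by
  simp only [accepts, Option.isSome_iff_exists, ← Option.mem_def, Part.dom_iff_mem,
    Code.evaln_complete]
  constructor
  · rintro ⟨n, v, hv⟩
    exact ⟨_, List.prefix_append _ _, v, _, hv⟩
  · rintro ⟨_, ⟨ρ, rfl⟩, v, k, hv⟩
    exact ⟨Nat.pair k (encode ρ), v, by simpa using hv⟩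

/-- The first extension of `s` found in the c.e. set of strings with index `c`. -/
def searchExt (c : Code) (s : List Bool) : Part (List Bool) :=
  (Nat.rfind fun n => Part.some (accepts c s n)).map fun n => s ++ strOf n.unpair.2

theorem partrec_searchExt : Partrec fun p : Code × List Bool => searchExt p.1 p.2 :=
  Partrec.map (Partrec.rfind (p := fun (p : Code × List Bool) n => Part.some (accepts p.1 p.2 n))
    computable_accepts.partrec)
    (Computable.list_append.comp (Computable.snd.comp Computable.fst) (primrec_strOf.to_comp.comp
      (Computable.snd.comp (Computable.unpair.comp Computable.snd))))

theorem searchExt_spec {c : Code} {s τ : List Bool} (h : τ ∈ searchExt c s) :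
    s <+: τ ∧ (c.eval (encode τ)).Dom := by
  simp only [searchExt, Part.mem_map_iff, mem_rfind_iff, Part.mem_some_iff] at h
  obtain ⟨n, ⟨hn, -⟩, rfl⟩ := h
  refine ⟨List.prefix_append _ _, Part.dom_iff_mem.2 ?_⟩
  obtain ⟨v, hv⟩ := Option.isSome_iff_exists.1 (show accepts c s n = true from hn.symm)
  exact ⟨v, Code.evaln_sound hv⟩

theorem searchExt_dom {c : Code} {s τ : List Bool} (hs : s <+: τ)
    (hτ : (c.eval (encode τ)).Dom) : (searchExt c s).Dom := by
  obtain ⟨n, hn⟩ := exists_accepts_iff.2 ⟨τ, hs, hτ⟩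
  exact (Nat.rfind_dom (p := fun n => Part.some (accepts c s n))).2 ⟨n, by simp [hn], by simp⟩

end Search

/-! ### The finite extension method -/

section Construction

open Nat.Partrec (Code)
open Encodable Denumerable

/-- The string `σ` decides the c.e. set of strings with index `c`: it belongs to it, or none of its
extensions does. -/
def Decides (c : Code) (σ : List Bool) : Prop :=
  (c.eval (encode σ)).Dom ∨ ∀ τ, σ <+: τ → ¬ (c.eval (encode τ)).Dom

theorem oneGeneric_of_decides {A : Set ℕ}
    (h : ∀ e, ∃ σ, IsInitialSegment σ A ∧ Decides (ofNat Code e) σ) : OneGeneric A := by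
  intro W hW
  obtain ⟨c, hc⟩ := hW.exists_code
  obtain ⟨σ, hσ, hd⟩ := h (encode c)
  rw [ofNat_encode] at hd
  exact ⟨σ, hσ, hd.imp (hc σ).2 fun h τ hτ hW => h τ hτ ((hc τ).1 hW)⟩

/-- The finite extension method: iterating a step that properly extends strings satisfying `P`
produces a set. -/
theorem exists_chain {P : List Bool → Prop} {R : ℕ → List Bool → List Bool → Prop} (h0 : P [])
    (step : ∀ e u, P u → ∃ v, P v ∧ u <+: v ∧ u.length < v.length ∧ R e u v) :
    ∃ (U : ℕ → List Bool) (A : Set ℕ), U 0 = [] ∧ ∀ e,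
      P (U e) ∧ IsInitialSegment (U e) A ∧ e ≤ (U e).length ∧ R e (U e) (U (e + 1)) := by
  choose! S hS using step
  let U : ℕ → List Bool := fun n => Nat.rec [] (fun e u => S e u) n
  have hU : ∀ e, U (e + 1) = S e (U e) := fun _ => rfl
  have hP : ∀ e, P (U e) := by
    intro e
    induction e with
    | zero => exact h0
    | succ e ih => exact hU e ▸ (hS e _ ih).1
  have hmono : ∀ {m n}, m ≤ n → U m <+: U n := by
    intro m n h
    induction h with
    | refl => exact List.prefix_rfl
    | step _ ih => exact ih.trans (hU _ ▸ (hS _ _ (hP _)).2.1)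
  refine ⟨U, {i | ∃ e, (U e)[i]? = some true}, rfl, fun e => ⟨hP e, ?_, ?_, ?_⟩⟩
  · rw [isInitialSegment_iff]
    intro i b hb
    constructor
    · rintro rfl
      exact ⟨e, hb⟩
    · rintro ⟨e', he'⟩
      have key : ∀ {m n : ℕ} {x : Bool}, m ≤ n → (U m)[i]? = some x → (U n)[i]? = some x := by
        intro m n x h hx
        obtain ⟨t, ht⟩ := hmono h
        rw [← ht, List.getElem?_append_left (List.getElem?_eq_some_iff.1 hx).1, hx]
      have h1 := key (le_max_left e e') hb
      have h2 := key (le_max_right e e') he'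
      simpa [h1] using h2
  · induction e with
    | zero => exact Nat.zero_le _
    | succ e ih =>
      have := (hS e _ (hP e)).2.2.1
      rw [hU]
      omega
  · exact hU e ▸ (hS e _ (hP e)).2.2.2

theorem primrec_replicate (b : Bool) : Primrec fun n => List.replicate n b :=
  (Primrec.list_map Primrec.list_range (Primrec.const b).to₂).of_eq fun n => by
    simp [List.map_const']

end Construction

/-! ### Hyperimmune sets and block sequences -/

section Hyperimmune

open Nat.Partrec (Code)
open Encodable Denumerable

/-- If, for every `k`, the search for an extension of `u1^k` in a c.e. set succeeds, and no
extension of `u` in that set is `1` throughout `I`, then the extensions found give a computable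
sequence of disjoint intervals meeting `I`. -/
theorem exists_intervals_of_search {I : Set ℕ} {c : Code} {u : List Bool}
    (hu : ∀ i ∈ I, i < u.length → u[i]? = some true)
    (hdom : ∀ k, (searchExt c (u ++ List.replicate k true)).Dom)
    (hbad : ∀ τ, u <+: τ → (c.eval (encode τ)).Dom →
      ¬ ∀ i ∈ I, i < τ.length → τ[i]? = some true) :
    ∃ F : ℕ → List ℕ, Computable F ∧
      (∀ m n : ℕ, m ≠ n → List.Disjoint (F m) (F n)) ∧ ∀ n : ℕ, ∃ x ∈ F n, x ∈ I := by
  let t : ℕ → List Bool := fun k => (searchExt c (u ++ List.replicate k true)).get (hdom k)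
  have ht : Computable t := by
    refine Partrec.of_eq_tot (f := fun k => searchExt c (u ++ List.replicate k true)) ?_
      fun k => Part.get_mem _
    exact partrec_searchExt.comp ((Computable.const c).pair
      (Primrec.list_append.comp (Primrec.const u) (primrec_replicate true)).to_comp)
  have hspec : ∀ k, u ++ List.replicate k true <+: t k ∧ (c.eval (encode (t k))).Dom :=
    fun k => searchExt_spec (Part.get_mem (hdom k))
  have hmeet : ∀ k, ∃ i ∈ I, u.length + k ≤ i ∧ i < (t k).length := by
    intro k
    have := hbad (t k) ((List.prefix_append _ _).trans (hspec k).1) (hspec k).2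
    push Not at this
    obtain ⟨i, hi, hlt, hne⟩ := this
    refine ⟨i, hi, ?_, hlt⟩
    by_contra hik
    push Not at hik
    apply hne
    obtain ⟨r, hr⟩ := (hspec k).1
    rw [← hr, List.getElem?_append_left (by simpa using hik)]
    by_cases hiu : i < u.length
    · rw [List.getElem?_append_left hiu, hu i hi hiu]
    · rw [List.getElem?_append_right (by omega), List.getElem?_replicate_of_lt (by omega)]
  let K : ℕ → ℕ := fun n => Nat.rec 0 (fun _ k => (t k).length) n
  have hK : Computable K := Computable.nat_rec Computable.id (Computable.const 0)
    (Computable.list_length.comp (ht.comp (Computable.snd.comp Computable.snd))).to₂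
  have hK1 : ∀ n, K (n + 1) = (t (K n)).length := fun _ => rfl
  have hmono : Monotone K := by
    refine monotone_nat_of_le_succ fun n => ?_
    have := (hspec (K n)).1.length_le
    simp only [List.length_append, List.length_replicate] at this
    rw [hK1]
    omega
  refine ⟨fun n => (List.range (K (n + 1) - K n)).map fun i => u.length + K n + i, ?_, ?_, ?_⟩
  · have h : Primrec fun p : ℕ × ℕ => (List.range (p.1 - p.2)).map fun i => u.length + p.2 + i :=
      Primrec.list_map (Primrec.list_range.comp (Primrec.nat_sub.comp Primrec.fst Primrec.snd))
        (Primrec.nat_add.comp (Primrec.nat_add.comp (Primrec.const _)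
          (Primrec.snd.comp Primrec.fst)) Primrec.snd)
    exact h.to_comp.comp ((hK.comp Computable.succ).pair hK)
  · have hlt : ∀ m n : ℕ, m < n → List.Disjoint
        ((List.range (K (m + 1) - K m)).map fun i => u.length + K m + i)
        ((List.range (K (n + 1) - K n)).map fun i => u.length + K n + i) := by
      intro m n h x hx hx'
      simp only [List.mem_map, List.mem_range] at hx hx'
      obtain ⟨i, hi, rfl⟩ := hx
      obtain ⟨j, hj, hij⟩ := hx'
      have := hmono (show m + 1 ≤ n from h)
      omega
    intro m n hmn
    rcases Nat.lt_or_gt_of_ne hmn with h | h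
    · exact hlt m n h
    · exact (hlt n m h).symm
  · intro n
    obtain ⟨i, hi, h1, h2⟩ := hmeet (K n)
    refine ⟨i, List.mem_map.2 ⟨i - (u.length + K n), ?_, by omega⟩, hi⟩
    rw [List.mem_range, hK1]
    omega

theorem exists_oneGeneric_superset {I : Set ℕ} (hI : Hyperimmune I) :
    ∃ G, OneGeneric G ∧ I ⊆ G := by
  obtain ⟨U, G, -, hU⟩ := exists_chain
    (P := fun u => ∀ i ∈ I, i < u.length → u[i]? = some true)
    (R := fun e _ v => ∃ σ, σ <+: v ∧ Decides (ofNat Code e) σ) (by simp) (by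
      intro e u hu
      -- Appending `1`s to a good string keeps it good.
      have happ : ∀ v : List Bool, (∀ i ∈ I, i < v.length → v[i]? = some true) → ∀ k,
          ∀ i ∈ I, i < (v ++ List.replicate k true).length →
            (v ++ List.replicate k true)[i]? = some true := by
        intro v hv k i hi hlt
        by_cases hiv : i < v.length
        · rw [List.getElem?_append_left hiv, hv i hi hiv]
        · rw [List.length_append, List.length_replicate] at hlt
          rw [List.getElem?_append_right (by omega), List.getElem?_replicate_of_lt (by omega)]
      by_cases h1 : ∃ k, ∀ τ, u ++ List.replicate k true <+: τ →
          ¬ ((ofNat Code e).eval (encode τ)).Dom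
      · obtain ⟨k, hk⟩ := h1
        exact ⟨u ++ List.replicate (k + 1) true, happ u hu _, List.prefix_append _ _, by simp,
          u ++ List.replicate k true, by
            rw [List.replicate_succ', ← List.append_assoc]; exact List.prefix_append _ _,
          Or.inr hk⟩
      by_cases h2 : ∃ τ, u <+: τ ∧ ((ofNat Code e).eval (encode τ)).Dom ∧
          ∀ i ∈ I, i < τ.length → τ[i]? = some true
      · obtain ⟨τ, hτ, hd, hg⟩ := h2
        refine ⟨τ ++ List.replicate 1 true, happ τ hg 1, hτ.trans (List.prefix_append _ _), ?_,
          τ, List.prefix_append _ _, Or.inl hd⟩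
        have := hτ.length_le
        simp only [List.length_append, List.length_replicate]
        omega
      · push Not at h1 h2
        refine absurd (exists_intervals_of_search (c := ofNat Code e) hu (fun k => ?_)
          (fun τ hτ hd h => ?_)) hI.2
        · obtain ⟨τ, hτ, hd⟩ := h1 k
          exact searchExt_dom hτ hd
        · obtain ⟨i, hi, hlt, hne⟩ := h2 τ hτ hd
          exact hne (h i hi hlt))
  refine ⟨G, oneGeneric_of_decides fun e => ?_, fun i hi => ?_⟩
  · obtain ⟨-, -, -, σ, hσ, hd⟩ := hU e
    exact ⟨σ, (hU (e + 1)).2.1.of_prefix hσ, hd⟩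
  · obtain ⟨h1, h2, h3, -⟩ := hU (i + 1)
    exact (isInitialSegment_iff.1 h2 i true (h1 i hi h3)).1 rfl

theorem subsequence_eq_univ {G I : Set ℕ} (hI : I.Infinite) (h : I ⊆ G) :
    subsequence G I = Set.univ :=
  Set.eq_univ_of_forall fun n => h (Nat.nth_mem_of_infinite hI n)

theorem not_oneGeneric_univ : ¬ OneGeneric Set.univ := by
  intro h
  have hre : REPred fun σ : List Bool => ∃ b ∈ σ, b = false :=
    (PrimrecPred.exists_mem_list
      (Primrec.eq.comp Primrec.id (Primrec.const false))).computablePred.to_re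
  obtain ⟨σ, hσ, ⟨b, hb, rfl⟩ | hno⟩ := h {σ | ∃ b ∈ σ, b = false} hre
  · obtain ⟨i, hi, hb⟩ := List.mem_iff_getElem.1 hb
    have := (hσ i hi).2 (Set.mem_univ i)
    simp [hb] at this
  · exact hno (σ ++ [false]) (List.prefix_append _ _) ⟨false, by simp, rfl⟩

/-- From a computable sequence of disjoint finite sets meeting `X`, a computable subsequence of sets
lying in successive open intervals is extracted by unbounded search. -/
theorem exists_blocks_of_not_hyperimmune {X : Set ℕ} (hinf : X.Infinite) (h : ¬ Hyperimmune X) :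
    ∃ f : ℕ → ℕ, Computable f ∧ StrictMono f ∧
      ∀ n : ℕ, (X ∩ Set.Ioo (f n) (f (n + 1))).Nonempty := by
  obtain ⟨F, hF, hdisj, hmeet⟩ : ∃ F : ℕ → List ℕ, Computable F ∧
      (∀ m n : ℕ, m ≠ n → List.Disjoint (F m) (F n)) ∧ ∀ n : ℕ, ∃ x ∈ F n, x ∈ X := by
    by_contra hc
    exact h ⟨hinf, hc⟩
  have hex : ∀ a : ℕ, ∃ n : ℕ, ∀ x ∈ F n.unpair.1, a < x ∧ x < n.unpair.2 := by
    intro a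
    -- At most `a + 1` of the disjoint sets have an element `≤ a`.
    obtain ⟨m, hm⟩ : ∃ m, ∀ x ∈ F m, a < x := by
      by_contra! hc
      choose g hg hga using hc
      obtain ⟨m, -, n, -, hne, heq⟩ := Finset.exists_ne_map_eq_of_card_lt_of_maps_to
        (s := Finset.range (a + 2)) (t := Finset.range (a + 1)) (f := g) (by simp)
        (fun m _ => by simpa using Nat.lt_succ_of_le (hga m))
      exact hdisj m n hne (hg m) (heq ▸ hg n)
    obtain ⟨b, hb⟩ := (F m).toFinset.exists_nat_subset_range
    refine ⟨Nat.pair m b, fun x hx => ?_⟩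
    simp only [Nat.unpair_pair] at hx ⊢
    exact ⟨hm x hx, Finset.mem_range.1 (hb (List.mem_toFinset.2 hx))⟩
  have hcomp : ComputablePred fun p : ℕ × ℕ =>
      ∀ x ∈ F p.2.unpair.1, p.1 < x ∧ x < p.2.unpair.2 := by
    have hR : PrimrecRel fun (x : ℕ) (p : ℕ × ℕ) => p.1 < x ∧ x < p.2 :=
      PrimrecPred.and (Primrec.nat_lt.comp (Primrec.fst.comp Primrec.snd) Primrec.fst)
        (Primrec.nat_lt.comp Primrec.fst (Primrec.snd.comp Primrec.snd))
    have h1 : ComputablePred fun q : List ℕ × (ℕ × ℕ) => ∀ x ∈ q.1, q.2.1 < x ∧ x < q.2.2 :=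
      PrimrecPred.computablePred hR.forall_mem_list
    exact h1.comp (f := fun p : ℕ × ℕ => (F p.2.unpair.1, p.1, p.2.unpair.2))
      ((hF.comp (Computable.fst.comp (Computable.unpair.comp Computable.snd))).pair
        (Computable.fst.pair (Computable.snd.comp (Computable.unpair.comp Computable.snd))))
  let N : ℕ → ℕ := fun a => (Nat.find (hex a)).unpair.2
  have hN : Computable N :=
    Computable.snd.comp (Computable.unpair.comp (Computable.find hcomp hex))
  have hNspec : ∀ a, ∃ x ∈ X, a < x ∧ x < N a := by
    intro a
    obtain ⟨x, hx, hxX⟩ := hmeet (Nat.find (hex a)).unpair.1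
    exact ⟨x, hxX, Nat.find_spec (hex a) x hx⟩
  refine ⟨fun n => Nat.rec 0 (fun _ a => N a) n, ?_, ?_, ?_⟩
  · exact Computable.nat_rec Computable.id (Computable.const 0)
      (hN.comp (Computable.snd.comp Computable.snd)).to₂
  · refine strictMono_nat_of_lt_succ fun n => ?_
    obtain ⟨x, -, h1, h2⟩ := hNspec (Nat.rec 0 (fun _ a => N a) n)
    exact h1.trans h2
  · intro n
    obtain ⟨x, hx, h1, h2⟩ := hNspec (Nat.rec 0 (fun _ a => N a) n)
    exact ⟨x, hx, h1, h2⟩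

theorem infinite_of_not_isComputableSet {I : Set ℕ} (h : ¬ IsComputableSet I) : I.Infinite := by
  intro hfin
  apply h
  have : PrimrecPred fun n => n ∈ I := by
    refine (Primrec.eq.exists_mem_list.comp (Primrec.const hfin.toFinset.toList)
      Primrec.id).of_eq fun n => ?_
    simp
  exact this.computablePred

end Hyperimmune

/-! ### Counting functions -/

section Counting

open Classical in
/-- The number of elements of `I` below `x`. -/
noncomputable def countBelow (I : Set ℕ) (x : ℕ) : ℕ := Nat.count (fun k => k ∈ I) x

variable {I : Set ℕ}

theorem countBelow_le (x : ℕ) : countBelow I x ≤ x := by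
  classical
  exact Nat.count_le _

theorem countBelow_mono {x y : ℕ} (h : x ≤ y) : countBelow I x ≤ countBelow I y := by
  classical
  exact Nat.count_monotone _ h

theorem countBelow_lt {x y i : ℕ} (hi : i ∈ I) (hx : x ≤ i) (hy : i < y) :
    countBelow I x < countBelow I y := by
  classical
  exact (countBelow_mono hx).trans_lt (Nat.count_strict_mono hi hy)

theorem countBelow_succ_eq_iff {x : ℕ} : countBelow I (x + 1) = countBelow I x + 1 ↔ x ∈ I := by
  classical
  unfold countBelow
  rw [Nat.count_succ]
  split_ifs with h <;> simp [h]

theorem countBelow_principalFunction (hI : I.Infinite) (n : ℕ) :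
    countBelow I (principalFunction I n) = n := by
  classical
  exact Nat.count_nth_of_infinite (p := fun k => k ∈ I) hI n

theorem le_principalFunction_iff (hI : I.Infinite) {x n : ℕ} :
    x ≤ principalFunction I n ↔ countBelow I x ≤ n := by
  classical
  exact (Nat.count_le_iff_le_nth (p := fun k => k ∈ I) hI).symm

theorem principalFunction_lt_iff (hI : I.Infinite) {x n : ℕ} :
    principalFunction I n < x ↔ n < countBelow I x := by
  rw [← not_le, le_principalFunction_iff hI, not_le]

theorem le_principalFunction (hI : I.Infinite) (n : ℕ) : n ≤ principalFunction I n :=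
  (le_principalFunction_iff hI).2 (countBelow_le n)

/-- If the graph of the counting function of `I` is c.e. from some point on, then `I` is
computable. -/
theorem isComputableSet_of_countBelow {l : ℕ} {q : ℕ × ℕ → ℕ → Bool} (hq : Computable₂ q)
    (h : ∀ x m, (∃ n, q (x, m) n = true) ↔ countBelow I (l + x) = m) : IsComputableSet I := by
  classical
  have hex : ∀ x : ℕ, ∃ n : ℕ, q (x, n.unpair.1) n.unpair.2 = true := by
    intro x
    obtain ⟨n, hn⟩ := (h x _).2 rfl
    exact ⟨Nat.pair _ n, by simpa using hn⟩
  have hc : Computable fun x => countBelow I (l + x) := by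
    have hP : ComputablePred fun p : ℕ × ℕ => q (p.1, p.2.unpair.1) p.2.unpair.2 = true :=
      Computable.computablePred (by
        simpa using hq.comp
          (Computable.fst.pair (Computable.fst.comp (Computable.unpair.comp Computable.snd)))
          (Computable.snd.comp (Computable.unpair.comp Computable.snd)))
    refine (Computable.fst.comp (Computable.unpair.comp (Computable.find hP hex))).of_eq fun x => ?_
    exact ((h x _).1 ⟨_, Nat.find_spec (hex x)⟩).symm
  have hlow : Computable fun i => decide (i ∈ I ∩ Set.Iio l) := by
    have hfin : (I ∩ Set.Iio l).Finite := (Set.finite_Iio l).inter_of_right I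
    by_contra hcon
    exact infinite_of_not_isComputableSet (I := I ∩ Set.Iio l)
      (fun hcomp => hcon (ComputablePred.decide hcomp)) hfin
  have hhigh : Computable fun i =>
      decide (countBelow I (l + (i - l + 1)) = countBelow I (l + (i - l)) + 1) := by
    have hsub : Computable fun i : ℕ => i - l :=
      (Primrec.nat_sub.comp Primrec.id (Primrec.const l)).to_comp
    exact Primrec.eq.decide.to_comp.comp (hc.comp (Computable.succ.comp hsub))
      (Computable.succ.comp (hc.comp hsub))
  refine Computable.computablePred ((Computable.cond
    (Primrec.nat_lt.decide.comp Primrec.id (Primrec.const l)).to_comp hlow hhigh).of_eq fun i => ?_)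
  by_cases hi : i < l
  · simp [hi]
  · have e : l + (i - l) = i := by omega
    simp only [id, hi, decide_false, cond_false, ← add_assoc, e, countBelow_succ_eq_iff]

end Counting

/-! ### Padding strings -/

section Padding

/-- The extension of `σ` to length `n` by copies of the bit `b` (`σ` itself if it is longer). -/
def padTo (σ : List Bool) (b : Bool) (n : ℕ) : List Bool :=
  σ ++ List.replicate (n - σ.length) b

theorem length_padTo {σ : List Bool} {b : Bool} {n : ℕ} (h : σ.length ≤ n) :
    (padTo σ b n).length = n := by
  simp [padTo, h]

theorem prefix_padTo (σ : List Bool) (b : Bool) (n : ℕ) : σ <+: padTo σ b n :=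
  List.prefix_append _ _

theorem IsInitialSegment.mem_iff_of_padTo {σ : List Bool} {b : Bool} {n i : ℕ} {A : Set ℕ}
    (h : IsInitialSegment (padTo σ b n) A) (h1 : σ.length ≤ i) (h2 : i < n) : i ∈ A ↔ b = true := by
  refine (isInitialSegment_iff.1 h i b ?_).symm
  rw [padTo, List.getElem?_append_right h1, List.getElem?_replicate_of_lt (by omega)]

theorem Computable.padTo {α : Type*} [Primcodable α] {σ : α → List Bool} {b : Bool} {n : α → ℕ}
    (hσ : Computable σ) (hn : Computable n) : Computable fun a => padTo (σ a) b (n a) :=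
  Computable.list_append.comp hσ ((primrec_replicate b).to_comp.comp
    (Primrec.nat_sub.to_comp.comp hn (Computable.list_length.comp hσ)))

end Padding

/-! ### Messages -/

section Stage

open Encodable

/-- A sequence whose intervals `[growth f k, f (growth f k)]` are pairwise disjoint. -/
def growth (f : ℕ → ℕ) (k : ℕ) : ℕ := Nat.rec 0 (fun _ g => f g + 1) k

theorem Computable.growth {f : ℕ → ℕ} (hf : Computable f) : Computable (growth f) :=
  Computable.nat_rec Computable.id (Computable.const 0)
    (Computable.succ.comp (hf.comp (Computable.snd.comp Computable.snd))).to₂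

theorem strictMono_growth {f : ℕ → ℕ} (hf : StrictMono f) : StrictMono (growth f) :=
  strictMono_nat_of_lt_succ fun n => Nat.lt_succ_of_le (hf.le_apply (x := growth f n))

/-- Any number in `[growth f k, f (growth f k)]` determines `k`, computably. -/
theorem exists_computable_level {f : ℕ → ℕ} (hf : Computable f) (hm : StrictMono f) :
    ∃ D : ℕ → ℕ, Computable D ∧ ∀ k q, growth f k ≤ q → q ≤ f (growth f k) → D q = k := by
  have hex : ∀ q, ∃ k, q < growth f (k + 1) :=
    fun q => ⟨q, (Nat.lt_succ_self q).trans_le (strictMono_growth hm).le_apply⟩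
  have hP : ComputablePred fun p : ℕ × ℕ => p.1 < growth f (p.2 + 1) :=
    Computable.computablePred (Primrec.nat_lt.decide.to_comp.comp Computable.fst
      (hf.growth.comp (Computable.succ.comp Computable.snd)))
  refine ⟨fun q => Nat.find (hex q), Computable.find hP hex, fun k q h1 h2 => ?_⟩
  rw [Nat.find_eq_iff]
  refine ⟨Nat.lt_succ_of_le h2, fun n hn hlt => ?_⟩
  have := (strictMono_growth hm).monotone (show n + 1 ≤ k from hn)
  omega

/-- The content of a message: the string `u` it is appended to, an offset `x`, a guess `m` for the
number of elements of `I` below `|u| + x`, and a bit of `∅'`. -/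
abbrev Message := List Bool × ℕ × ℕ × Bool

/-- The first position after the leading run of `1`s of a message. -/
def Message.cut (μ : Message) : ℕ := μ.1.length + μ.2.1

/-- The level at which a message is written. The second component of the pair makes the level large
enough for the message to be longer than its first two runs. -/
def Message.level (μ : Message) : ℕ := Nat.pair (encode μ) (μ.cut + 2)

/-- A message is written after `u` as four runs `1…10…01…10…0`, the third of which ends at position
`f (growth f k)` for the level `k` that codes the message. No reference is made to `I`. -/
def Message.write (f : ℕ → ℕ) (μ : Message) : List Bool :=
  padTo (padTo (padTo (padTo μ.1 true μ.cut) false (f (μ.cut + 1)))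
    true (f (growth f μ.level))) false (f (growth f μ.level + 1))

theorem Message.computable_cut : Computable Message.cut :=
  (Primrec.nat_add.comp (Primrec.list_length.comp Primrec.fst)
    (Primrec.fst.comp Primrec.snd)).to_comp

theorem Message.computable_write {f : ℕ → ℕ} (hf : Computable f) :
    Computable (Message.write f) := by
  have hc := Message.computable_cut
  have hl : Computable fun μ : Message => growth f μ.level :=
    hf.growth.comp (Primrec₂.natPair.to_comp.comp Computable.encode
      (Computable.succ.comp (Computable.succ.comp hc)))
  exact (((Computable.fst.padTo hc).padTo (hf.comp (Computable.succ.comp hc))).padTo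
    (hf.comp hl)).padTo (hf.comp (Computable.succ.comp hl))

variable {f : ℕ → ℕ}

theorem Message.cut_lt (hm : StrictMono f) (μ : Message) : μ.cut < f (μ.cut + 1) :=
  hm.le_apply (x := μ.cut + 1)

theorem Message.cut_add_two_le (hm : StrictMono f) (μ : Message) :
    μ.cut + 2 ≤ growth f μ.level :=
  (Nat.right_le_pair _ _).trans (strictMono_growth hm).le_apply

theorem Message.length_le_cut (μ : Message) : (padTo μ.1 true μ.cut).length = μ.cut :=
  length_padTo (Nat.le_add_right _ _)

theorem Message.length_padTo_two (hm : StrictMono f) (μ : Message) :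
    (padTo (padTo μ.1 true μ.cut) false (f (μ.cut + 1))).length = f (μ.cut + 1) :=
  length_padTo (by rw [μ.length_le_cut]; exact (μ.cut_lt hm).le)

theorem Message.length_padTo_three (hm : StrictMono f) (μ : Message) :
    (padTo (padTo (padTo μ.1 true μ.cut) false (f (μ.cut + 1)))
      true (f (growth f μ.level))).length = f (growth f μ.level) :=
  length_padTo (by
    rw [μ.length_padTo_two hm]
    exact hm.monotone (by have := μ.cut_add_two_le hm; omega))

theorem Message.length_write (hm : StrictMono f) (μ : Message) :
    (μ.write f).length = f (growth f μ.level + 1) :=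
  length_padTo (by rw [μ.length_padTo_three hm]; exact hm.monotone (Nat.le_succ _))

theorem Message.prefix_write (μ : Message) : μ.1 <+: μ.write f :=
  (prefix_padTo _ _ _).trans ((prefix_padTo _ _ _).trans
    ((prefix_padTo _ _ _).trans (prefix_padTo _ _ _)))

theorem Message.length_lt_length_write (hm : StrictMono f) (μ : Message) :
    μ.1.length < (μ.write f).length := by
  rw [μ.length_write hm]
  have h1 := μ.cut_add_two_le hm
  have h2 := hm.le_apply (x := growth f μ.level + 1)
  have h3 : μ.1.length ≤ μ.cut := Nat.le_add_right _ _
  omega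

/-- The bits of a set that has a written message as an initial segment. -/
theorem Message.mem_iff_of_write (hm : StrictMono f) {μ : Message} {A : Set ℕ}
    (h : IsInitialSegment (μ.write f) A) :
    (∀ i, μ.1.length ≤ i → i < μ.cut → (i ∈ A ↔ true = true)) ∧
    (∀ i, μ.cut ≤ i → i < f (μ.cut + 1) → (i ∈ A ↔ false = true)) ∧
    (∀ i, f (μ.cut + 1) ≤ i → i < f (growth f μ.level) → (i ∈ A ↔ true = true)) ∧
    (∀ i, f (growth f μ.level) ≤ i → i < f (growth f μ.level + 1) →
      (i ∈ A ↔ false = true)) := by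
  have h3 := h.of_prefix (prefix_padTo _ _ _)
  have h2 := h3.of_prefix (prefix_padTo _ _ _)
  have h1 := h2.of_prefix (prefix_padTo _ _ _)
  refine ⟨fun i hi => h1.mem_iff_of_padTo hi, fun i hi => h2.mem_iff_of_padTo ?_,
    fun i hi => h3.mem_iff_of_padTo ?_, fun i hi => h.mem_iff_of_padTo ?_⟩
  · rwa [μ.length_le_cut]
  · rwa [μ.length_padTo_two hm]
  · rwa [μ.length_padTo_three hm]

end Stage

/-! ### Decoding -/

section Decoding

open Nat.Partrec (Code)
open Encodable Denumerable

/-- The first position `≥ P` at which the string `ρ` has the bit `b`. -/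
def firstIdx (ρ : List Bool) (b : Bool) (P : ℕ) : Part ℕ :=
  Nat.rfind fun i => Part.some (decide (P ≤ i ∧ ρ[i]? = some b))

theorem Partrec.firstIdx {α : Type*} [Primcodable α] {ρ : α → List Bool} {b : Bool} {P : α → ℕ}
    (hρ : Computable ρ) (hP : Computable P) : Partrec fun a => firstIdx (ρ a) b (P a) := by
  have h : PrimrecPred fun p : (List Bool × ℕ) × ℕ => p.1.2 ≤ p.2 ∧ p.1.1[p.2]? = some b :=
    (Primrec.nat_le.comp (Primrec.snd.comp Primrec.fst) Primrec.snd).and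
      (Primrec.eq.comp (Primrec.list_getElem?.comp (Primrec.fst.comp Primrec.fst) Primrec.snd)
        (Primrec.const (some b)))
  exact (Partrec.rfind (p := fun (p : List Bool × ℕ) i =>
    Part.some (decide (p.2 ≤ i ∧ p.1[i]? = some b))) h.decide.to_comp.partrec).comp (hρ.pair hP)

theorem mem_firstIdx_initSeg {X : Set ℕ} {n P q q' : ℕ} {b : Bool} (hPq : P ≤ q)
    (hlt : ∀ i, P ≤ i → i < q → ¬ (i ∈ X ↔ b = true)) (hq : q ∈ X ↔ b = true) :
    q' ∈ firstIdx (initSeg X n) b P ↔ q' = q ∧ q < n := by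
  simp only [firstIdx, mem_rfind_iff, Part.mem_some_iff, getElem?_initSeg_eq_some, true_eq_decide_iff,
    false_eq_decide_iff]
  constructor
  · rintro ⟨⟨h1, h2, h3⟩, h4⟩
    have e : q' = q := by
      rcases lt_trichotomy q' q with h | h | h
      · exact absurd h3.symm (hlt q' h1 h)
      · exact h
      · exact absurd ⟨hPq, h.trans h2, hq.symm⟩ (h4 q h)
    exact ⟨e, e ▸ h2⟩
  · rintro ⟨rfl, h⟩
    exact ⟨⟨hPq, h, hq.symm⟩, fun m hm h' => hlt m h'.1 hm h'.2.2.symm⟩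

/-- If `A` is constant on `[a, b)` and takes the other value on `[b, c)`, and `I` meets `[b, c)`,
then the place where the `I`-subsequence of `A` changes its value is the number of elements of `I`
below `b`. -/
theorem mem_firstIdx_subsequence {A I : Set ℕ} (hI : I.Infinite) {a b c n q : ℕ} {v w : Bool}
    (hab : a ≤ b) (h1 : ∀ i, a ≤ i → i < b → (i ∈ A ↔ v = true))
    (h2 : ∀ i, b ≤ i → i < c → (i ∈ A ↔ w = true)) (hvw : v ≠ w)
    (hmeet : ∃ i ∈ I, b ≤ i ∧ i < c) :
    q ∈ firstIdx (initSeg (subsequence A I) n) w (countBelow I a) ↔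
      q = countBelow I b ∧ countBelow I b < n := by
  refine mem_firstIdx_initSeg (countBelow_mono hab) (fun i hi hi' => ?_) ?_
  · have e := h1 (principalFunction I i) ((le_principalFunction_iff hI).2 hi)
      ((principalFunction_lt_iff hI).2 hi')
    change ¬ (principalFunction I i ∈ A ↔ w = true)
    rw [e]
    revert hvw
    cases v <;> cases w <;> simp
  · obtain ⟨i, hi, hb, hc⟩ := hmeet
    exact h2 (principalFunction I _) ((le_principalFunction_iff hI).2 le_rfl)
      ((principalFunction_lt_iff hI).2 (countBelow_lt hi hb hc))

/-- One stage of decoding: from a prefix `ρ` of the `I`-subsequence and the position `P` at which the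
message of stage `e` starts, compute the position at which the next message starts and the bit sent.
Here `D` recovers the level of a message from the position at which its third run ends. -/
def decodeStage (f D : ℕ → ℕ) (ρ : List Bool) (e P : ℕ) : Part (ℕ × Bool) :=
  (firstIdx ρ false P).bind fun q₀ => (firstIdx ρ true q₀).bind fun q₁ =>
    (firstIdx ρ false q₁).bind fun q₂ =>
      let μ : Message := (decode (D q₂).unpair.1).getD ([], 0, 0, false)
      (bif decide (q₀ = μ.2.2.1) then Part.some (μ.write f)
        else searchExt (ofNat Code e) (μ.write f)).map fun τ => (τ.length, μ.2.2.2)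

theorem partrec_decodeStage {f D : ℕ → ℕ} (hf : Computable f) (hD : Computable D) :
    Partrec fun p : List Bool × ℕ × ℕ => decodeStage f D p.1 p.2.1 p.2.2 := by
  refine Partrec.bind (Partrec.firstIdx Computable.fst (Computable.snd.comp Computable.snd)) ?_
  refine Partrec.bind (Partrec.firstIdx (Computable.fst.comp Computable.fst) Computable.snd) ?_
  refine Partrec.bind (Partrec.firstIdx (Computable.fst.comp (Computable.fst.comp Computable.fst))
    Computable.snd) ?_
  have hμ : Computable fun p : ((((List Bool × ℕ × ℕ) × ℕ) × ℕ) × ℕ) =>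
      ((decode (D p.2).unpair.1).getD ([], 0, 0, false) : Message) :=
    Computable.option_getD (Computable.decode.comp (Computable.fst.comp (Computable.unpair.comp
      (hD.comp Computable.snd)))) (Computable.const _)
  have hw := (Message.computable_write hf).comp hμ
  refine Partrec.map (Partrec.cond (Primrec.eq.decide.to_comp.comp
    (Computable.snd.comp (Computable.fst.comp Computable.fst))
    (Computable.fst.comp (Computable.snd.comp (Computable.snd.comp hμ)))) hw.partrec
    (partrec_searchExt.comp (((Computable.ofNat Code).comp (Computable.fst.comp (Computable.snd.comp
      (Computable.fst.comp (Computable.fst.comp Computable.fst))))).pair hw))) ?_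
  exact ((Computable.list_length.comp Computable.snd).pair (Computable.snd.comp (Computable.snd.comp
    (Computable.snd.comp (hμ.comp Computable.fst))))).to₂

theorem Partrec.decodeStage {α : Type*} [Primcodable α] {f D : ℕ → ℕ} {ρ : α → List Bool}
    {e P : α → ℕ} (hf : Computable f) (hD : Computable D) (hρ : Computable ρ) (he : Computable e)
    (hP : Computable P) : Partrec fun a => decodeStage f D (ρ a) (e a) (P a) :=
  Partrec.comp (g := fun a => (ρ a, e a, P a)) (partrec_decodeStage hf hD) (hρ.pair (he.pair hP))

/-- The position at which the message of stage `e` starts. -/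
def decodePos (f D : ℕ → ℕ) (ρ : List Bool) (e : ℕ) : Part ℕ :=
  Nat.rec (Part.some 0) (fun e P => P.bind fun P => (decodeStage f D ρ e P).map Prod.fst) e

/-- The bit sent by the message of stage `e`. -/
def decodeBit (f D : ℕ → ℕ) (ρ : List Bool) (e : ℕ) : Part Bool :=
  (decodePos f D ρ e).bind fun P => (decodeStage f D ρ e P).map Prod.snd

theorem partrec_decodeBit {f D : ℕ → ℕ} (hf : Computable f) (hD : Computable D) :
    Partrec₂ fun ρ e => decodeBit f D ρ e := by
  have hpos : Partrec fun p : List Bool × ℕ => decodePos f D p.1 p.2 := by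
    refine Partrec.nat_rec (h := fun (p : List Bool × ℕ) (q : ℕ × ℕ) =>
      (decodeStage f D p.1 q.1 q.2).map Prod.fst) Computable.snd (Computable.const 0).partrec ?_
    exact Partrec.map (Partrec.decodeStage hf hD (Computable.fst.comp Computable.fst)
      (Computable.fst.comp Computable.snd) (Computable.snd.comp Computable.snd))
      (Computable.fst.comp Computable.snd).to₂
  exact Partrec.bind hpos (Partrec.map (Partrec.decodeStage hf hD
    (Computable.fst.comp Computable.fst) (Computable.snd.comp Computable.fst) Computable.snd)
    (Computable.snd.comp Computable.snd).to₂)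

end Decoding

/-! ### The coding construction -/

section Encoding

open Nat.Partrec (Code)
open Encodable Denumerable

/-- What stage `e` of the construction does to the string `u`. A message `μ` carrying `u` and the bit
`b` is written. If its guess is right, the written string has to decide the `e`-th c.e. set;
if it is wrong, the first extension found in that set is taken. Zeros are appended to the
result `τ` until exactly `|τ|` elements of `I` have been passed. -/
def IsStage (I : Set ℕ) (f : ℕ → ℕ) (b : Bool) (e : ℕ) (u v : List Bool) : Prop :=
  ∃ (μ : Message) (τ : List Bool), μ.1 = u ∧ μ.2.2.2 = b ∧ Decides (ofNat Code e) τ ∧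
    μ.write f <+: τ ∧
    (countBelow I μ.cut = μ.2.2.1 → τ = μ.write f) ∧
    (countBelow I μ.cut ≠ μ.2.2.1 → τ ∈ searchExt (ofNat Code e) (μ.write f)) ∧
    v = padTo τ false (principalFunction I τ.length)

/-- If no message would do, then a guess is right exactly if its message has an extension in the
`e`-th c.e. set, which makes `I` computable. -/
theorem exists_isStage {I : Set ℕ} (hI : ¬ IsComputableSet I) {f : ℕ → ℕ} (hf : Computable f)
    (hm : StrictMono f) (b : Bool) (e : ℕ) (u : List Bool) :
    ∃ v, u <+: v ∧ u.length < v.length ∧ IsStage I f b e u v := by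
  have hinf := infinite_of_not_isComputableSet hI
  obtain ⟨μ, τ, h1, h2, h3, h4, h5, h6⟩ : ∃ (μ : Message) (τ : List Bool), μ.1 = u ∧ μ.2.2.2 = b ∧
      Decides (ofNat Code e) τ ∧ μ.write f <+: τ ∧
      (countBelow I μ.cut = μ.2.2.1 → τ = μ.write f) ∧
      (countBelow I μ.cut ≠ μ.2.2.1 → τ ∈ searchExt (ofNat Code e) (μ.write f)) := by
    by_contra! hc
    refine hI (isComputableSet_of_countBelow (l := u.length)
      (q := fun p n => accepts (ofNat Code e) (Message.write f (u, p.1, p.2, b)) n) ?_ ?_)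
    · exact Computable.comp (g := fun p : (ℕ × ℕ) × ℕ =>
        ((ofNat Code e, Message.write f (u, p.1.1, p.1.2, b)), p.2)) computable_accepts
        (((Computable.const _).pair (Computable.comp
          (g := fun p : (ℕ × ℕ) × ℕ => (u, p.1.1, p.1.2, b)) (Message.computable_write hf)
          ((Computable.const u).pair ((Computable.fst.comp Computable.fst).pair
          ((Computable.snd.comp Computable.fst).pair (Computable.const b)))))).pair Computable.snd)
    · intro x m
      rw [exists_accepts_iff]
      set μ : Message := (u, x, m, b) with hμ
      constructor
      · rintro ⟨τ, hτ, hd⟩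
        by_contra hne
        obtain ⟨τ', hτ'⟩ := Part.dom_iff_mem.1 (searchExt_dom hτ hd)
        have hs := searchExt_spec hτ'
        exact (hc μ τ' rfl rfl (Or.inl hs.2) hs.1 (fun h => absurd h hne)).2 hτ'
      · intro heq
        by_contra! hno
        exact (hc μ (μ.write f) rfl rfl (Or.inr hno) List.prefix_rfl (fun _ => rfl)).1 heq
  have hpre : u <+: μ.write f := h1 ▸ μ.prefix_write
  have hlt : u.length < (μ.write f).length := h1 ▸ μ.length_lt_length_write hm
  refine ⟨_, (hpre.trans h4).trans (prefix_padTo _ _ _), ?_, μ, τ, h1, h2, h3, h4, h5, h6, rfl⟩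
  exact (hlt.trans_le h4.length_le).trans_le (prefix_padTo _ _ _).length_le

/-- One stage of decoding, run on the `I`-subsequence of a set extending the result of a stage of the
construction, is correct, and succeeds on long prefixes. -/
theorem exists_decodeStage_spec {I : Set ℕ} (hinf : I.Infinite) {f D : ℕ → ℕ} (hm : StrictMono f)
    (hmeet : ∀ n : ℕ, (I ∩ Set.Ioo (f n) (f (n + 1))).Nonempty)
    (hD : ∀ k q, growth f k ≤ q → q ≤ f (growth f k) → D q = k) {A : Set ℕ} {b : Bool} {e : ℕ}
    {u v : List Bool} (hs : IsStage I f b e u v) (hv : IsInitialSegment v A) :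
    ∃ N, ∀ n r, r ∈ decodeStage f D (initSeg (subsequence A I) n) e (countBelow I u.length) ↔
      r = (countBelow I v.length, b) ∧ N < n := by
  obtain ⟨μ, τ, rfl, rfl, -, h4, h5, h6, rfl⟩ := hs
  have hlen : countBelow I (padTo τ false (principalFunction I τ.length)).length = τ.length := by
    rw [length_padTo (le_principalFunction hinf _), countBelow_principalFunction hinf]
  obtain ⟨b1, b2, b3, b4⟩ := Message.mem_iff_of_write hm
    ((hv.of_prefix (prefix_padTo _ _ _)).of_prefix h4)
  have hcut := μ.cut_lt hm
  have hlev := μ.cut_add_two_le hm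
  have hle : f (μ.cut + 1) < f (growth f μ.level) := hm (by omega)
  -- `I` meets the second, the third and the fourth run of the message.
  have m1 : ∃ i ∈ I, μ.cut ≤ i ∧ i < f (μ.cut + 1) := by
    obtain ⟨i, hi, hi1, hi2⟩ := hmeet μ.cut
    exact ⟨i, hi, hm.le_apply.trans hi1.le, hi2⟩
  have m2 : ∃ i ∈ I, f (μ.cut + 1) ≤ i ∧ i < f (growth f μ.level) := by
    obtain ⟨i, hi, hi1, hi2⟩ := hmeet (μ.cut + 1)
    exact ⟨i, hi, hi1.le, hi2.trans_le (hm.monotone hlev)⟩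
  have m3 : ∃ i ∈ I, f (growth f μ.level) ≤ i ∧ i < f (growth f μ.level + 1) := by
    obtain ⟨i, hi, hi1, hi2⟩ := hmeet (growth f μ.level)
    exact ⟨i, hi, hi1.le, hi2⟩
  have hcount : ∀ n, n ≤ countBelow I (f n) := by
    intro n
    induction n with
    | zero => exact Nat.zero_le _
    | succ n ih =>
      obtain ⟨i, hi, hi1, hi2⟩ := hmeet n
      exact ih.trans_lt (countBelow_lt hi hi1.le hi2)
  have hDq : D (countBelow I (f (growth f μ.level))) = μ.level :=
    hD _ _ (hcount _) (countBelow_le _)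
  have e0 := fun n q => mem_firstIdx_subsequence (n := n) (q := q) hinf
    (Nat.le_add_right _ _ : μ.1.length ≤ μ.cut) b1 b2 (by decide) m1
  have e1 := fun n q => mem_firstIdx_subsequence (n := n) (q := q) hinf hcut.le b2 b3 (by decide) m2
  have e2 := fun n q => mem_firstIdx_subsequence (n := n) (q := q) hinf hle.le b3 b4 (by decide) m3
  have c1 : countBelow I μ.cut ≤ countBelow I (f (growth f μ.level)) :=
    countBelow_mono (hcut.trans hle).le
  have c2 : countBelow I (f (μ.cut + 1)) ≤ countBelow I (f (growth f μ.level)) :=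
    countBelow_mono hle.le
  have hdec : ((decode μ.level.unpair.1).getD ([], 0, 0, false) : Message) = μ := by
    simp [Message.level]
  have hlast : ∀ r, r ∈ (bif decide (countBelow I μ.cut = μ.2.2.1) then Part.some (μ.write f)
      else searchExt (ofNat Code e) (μ.write f)).map (fun τ => (τ.length, μ.2.2.2)) ↔
      r = (τ.length, μ.2.2.2) := by
    intro r
    by_cases hc : countBelow I μ.cut = μ.2.2.1
    · simp [hc, h5 hc]
    · simp [hc, Part.eq_some_iff.2 (h6 hc)]
  refine ⟨countBelow I (f (growth f μ.level)), fun n r => ?_⟩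
  rw [hlen, ← hlast r]
  simp only [decodeStage, Part.mem_bind_iff]
  constructor
  · rintro ⟨q0, hq0, q1, hq1, q2, hq2, hr⟩
    obtain ⟨rfl, -⟩ := (e0 n q0).1 hq0
    obtain ⟨rfl, -⟩ := (e1 n q1).1 hq1
    obtain ⟨rfl, hn⟩ := (e2 n q2).1 hq2
    rw [hDq, hdec] at hr
    exact ⟨hr, hn⟩
  · rintro ⟨hr, hn⟩
    refine ⟨_, (e0 n _).2 ⟨rfl, c1.trans_lt hn⟩, _, (e1 n _).2 ⟨rfl, c2.trans_lt hn⟩, _,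
      (e2 n _).2 ⟨rfl, hn⟩, ?_⟩
    rwa [hDq, hdec]

/-- If `I` is not computable but meets all blocks of a computable sequence, then the `I`-subsequence
of some 1-generic set computes `∅'`. -/
theorem exists_oneGeneric_haltingSet_le {I : Set ℕ} (hI : ¬ IsComputableSet I) {f : ℕ → ℕ}
    (hf : Computable f) (hm : StrictMono f)
    (hmeet : ∀ n : ℕ, (I ∩ Set.Ioo (f n) (f (n + 1))).Nonempty) :
    ∃ A, OneGeneric A ∧ SetTuringLE haltingSet (subsequence A I) := by
  classical
  have hinf := infinite_of_not_isComputableSet hI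
  obtain ⟨D, hDc, hD⟩ := exists_computable_level hf hm
  obtain ⟨U, A, hU0, hU⟩ := exists_chain (P := fun _ => True)
    (R := fun e u v => IsStage I f (decide (e ∈ haltingSet)) e u v) trivial
    (fun e u _ => by
      obtain ⟨v, h1, h2, h3⟩ := exists_isStage hI hf hm (decide (e ∈ haltingSet)) e u
      exact ⟨v, trivial, h1, h2, h3⟩)
  choose N hN using fun e =>
    exists_decodeStage_spec hinf hm hmeet hD (hU e).2.2.2 (hU (e + 1)).2.1
  have hsound : ∀ n e P, P ∈ decodePos f D (initSeg (subsequence A I) n) e →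
      P = countBelow I (U e).length := by
    intro n e
    induction e with
    | zero =>
      intro P hP
      rw [Part.mem_some_iff.1 hP, hU0]
      exact (Nat.le_zero.1 (countBelow_le 0)).symm
    | succ e ih =>
      intro P hP
      simp only [decodePos, Part.mem_bind_iff, Part.mem_map_iff] at hP
      obtain ⟨P', hP', r, hr, rfl⟩ := hP
      rw [ih P' hP'] at hr
      rw [((hN e n r).1 hr).1]
  have htotal : ∀ e, ∃ M, ∀ n, M ≤ n →
      countBelow I (U e).length ∈ decodePos f D (initSeg (subsequence A I) n) e := by
    intro e
    induction e with
    | zero =>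
      refine ⟨0, fun n _ => Part.mem_some_iff.2 ?_⟩
      rw [hU0]
      exact Nat.le_zero.1 (countBelow_le 0)
    | succ e ih =>
      obtain ⟨M, hM⟩ := ih
      refine ⟨max M (N e + 1), fun n hn => ?_⟩
      exact Part.mem_bind (hM n ((le_max_left _ _).trans hn))
        (Part.mem_map Prod.fst ((hN e n _).2 ⟨rfl, (le_max_right _ _).trans hn⟩))
  refine ⟨A, oneGeneric_of_decides fun e => ?_,
    setTuringLE_of_functional (partrec_decodeBit hf hDc) (fun n e b hb => ?_) fun e => ?_⟩
  · obtain ⟨-, -, -, μ, τ, -, -, hd, -, -, -, hv⟩ := hU e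
    refine ⟨τ, (hU (e + 1)).2.1.of_prefix ?_, hd⟩
    rw [hv]
    exact prefix_padTo _ _ _
  · simp only [decodeBit, Part.mem_bind_iff, Part.mem_map_iff] at hb
    obtain ⟨P, hP, r, hr, rfl⟩ := hb
    rw [hsound n e P hP] at hr
    rw [((hN e n r).1 hr).1]
    simp
  · obtain ⟨M, hM⟩ := htotal e
    exact ⟨max M (N e + 1), Part.dom_iff_mem.2 ⟨_, Part.mem_bind (hM _ (le_max_left _ _))
      (Part.mem_map Prod.snd ((hN e _ _).2 ⟨rfl, Nat.lt_of_succ_le (le_max_right _ _)⟩))⟩⟩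

end Encoding

/-! ### Subsequence sets -/

theorem mainTheorem2 :
    (∀ I : Set ℕ, IsSubsequenceSet I → IsComputableSet I) ∧
    ∀ I : Set ℕ, ¬ IsComputableSet I →
      (∃ G : Set ℕ, OneGeneric G ∧ ¬ OneGeneric (subsequence G I)) ∧
      (Hyperimmune I → ∃ G : Set ℕ, OneGeneric G ∧ I ⊆ G ∧
        subsequence G I = Set.univ ∧ ¬ OneGeneric (subsequence G I)) ∧
      (¬ Hyperimmune I → Wild I ∨ Tame I) ∧
      (Wild I → ∃ A : Set ℕ, OneGeneric A ∧
        SetTuringLE haltingSet (subsequence A I) ∧ ¬ OneGeneric (subsequence A I)) ∧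
      (Tame I → ∃ A : Set ℕ, OneGeneric A ∧
        SetTuringLE haltingSet (subsequence A I) ∧ ¬ OneGeneric (subsequence A I)) := by
  have hyper : ∀ I : Set ℕ, Hyperimmune I → ∃ G : Set ℕ, OneGeneric G ∧ I ⊆ G ∧
      subsequence G I = Set.univ ∧ ¬ OneGeneric (subsequence G I) := by
    intro I hI
    obtain ⟨G, hG, hIG⟩ := exists_oneGeneric_superset hI
    have huniv := subsequence_eq_univ hI.1 hIG
    exact ⟨G, hG, hIG, huniv, huniv ▸ not_oneGeneric_univ⟩
  have blocks : ∀ I : Set ℕ, ¬ IsComputableSet I → (∃ f : ℕ → ℕ, Computable f ∧ StrictMono f ∧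
      ∀ n : ℕ, (I ∩ Set.Ioo (f n) (f (n + 1))).Nonempty) → ∃ A : Set ℕ, OneGeneric A ∧
        SetTuringLE haltingSet (subsequence A I) ∧ ¬ OneGeneric (subsequence A I) := by
    rintro I hI ⟨f, hf, hm, hmeet⟩
    obtain ⟨A, hA, hle⟩ := exists_oneGeneric_haltingSet_le hI hf hm hmeet
    exact ⟨A, hA, hle, not_oneGeneric_of_haltingSet_le hle⟩
  have spoil : ∀ I : Set ℕ, ¬ IsComputableSet I →
      ∃ G : Set ℕ, OneGeneric G ∧ ¬ OneGeneric (subsequence G I) := by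
    intro I hI
    by_cases h : Hyperimmune I
    · obtain ⟨G, hG, -, -, hn⟩ := hyper I h
      exact ⟨G, hG, hn⟩
    · obtain ⟨A, hA, -, hn⟩ := blocks I hI
        (exists_blocks_of_not_hyperimmune (infinite_of_not_isComputableSet hI) h)
      exact ⟨A, hA, hn⟩
  refine ⟨fun I hI => ?_, fun I hI => ⟨spoil I hI, hyper I, fun h => ?_, ?_, ?_⟩⟩
  · by_contra hc
    obtain ⟨G, hG, hn⟩ := spoil I hc
    exact hn (hI.2 G hG)
  · obtain ⟨f, hf, hm, hmeet⟩ :=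
      exists_blocks_of_not_hyperimmune (infinite_of_not_isComputableSet hI) h
    by_cases hc : Computable (blockCount I f)
    · exact Or.inr ⟨hI, f, hf, hm, hmeet, hc⟩
    · exact Or.inl ⟨hI, f, hf, hm, hmeet, hc⟩
  · rintro ⟨-, f, hf, hm, hmeet, -⟩
    exact blocks I hI ⟨f, hf, hm, hmeet⟩
  · rintro ⟨-, f, hf, hm, hmeet, -⟩
    exact blocks I hI ⟨f, hf, hm, hmeet⟩
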